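/- Knots are oriented, and $\Delta^0_K(t)\in\mathbb Z[t]$ denotes the reduced Alexander polynomial of a knot $K$, that is, the determinant of the Alexander matrix of a diagram of $K$ with one row and one column deleted, multiplied by the unit $\pm t^{j}$ of $\mathbb Z[t,t^{-1}]$ that makes it a polynomial with positive constant coefficient. For coprime integers $n,m$ with $n>1$, an $(n,m)$-coloring of a knot diagram is a coloring of its arcs by elements of $\mathbb Z/n$ that satisfies the coloring condition of the linear Alexander quandle $x*y=mx+(1-m)y$ at each crossing: if $y$ is the color of the over-arc and $x,z$ are the colors of the incoming and outgoing under-arcs, then $z=x*y$ at a positive crossing and $x=z*y$ at a negative crossing. It is nontrivial if it is not constant. A knot $K$ displays Kauffman–Harary behavior mod $(p,m)$ if $p$ is prime, $1<m<\Delta^0_K(m)=p$, and some reduced alternating diagram of $K$ has a nontrivial $(p,m)$-coloring in which different arcs receive different colors. **Proposition.** Let $b$ be an odd integer and let $T_{2,b}$ be the $(2,b)$ torus knot. Let $m>1$ be an integer such that $p=\Delta^0_{T_{2,b}}(m)$ is prime. Then $T_{2,b}$ displays Kauffman–Harary behavior mod $(p,m)$. -/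

import Mathlib

open scoped Topology ContDiff

/-- The velocity of a closed curve in `ℝ³`, parametrised by the circle `ℝ / 2πℤ`, at `θ`. -/
noncomputable def curveVelocity (γ : Real.Angle → Fin 3 → ℝ) (θ : Real.Angle) : Fin 3 → ℝ :=
  deriv (fun t : ℝ => γ (θ + (t : Real.Angle))) 0

/-- An oriented smooth knot in `ℝ³`: a smooth regular embedding of the circle. -/
structure Knot where
  /-- the parametrisation -/
  curve : Real.Angle → Fin 3 → ℝ
  smooth : ContDiff ℝ ∞ (fun t : ℝ => curve (t : Real.Angle))
  regular : ∀ θ, curveVelocity curve θ ≠ 0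
  injective : Function.Injective curve

/-- Equivalence of oriented knots: an ambient isotopy `H` of `ℝ³` carries `K` to `K'`, up to an
orientation preserving reparametrisation of the circle (with lift `φ`). -/
def Knot.Equivalent (K K' : Knot) : Prop :=
  ∃ H : unitInterval → ((Fin 3 → ℝ) ≃ₜ (Fin 3 → ℝ)),
    Continuous (fun q : unitInterval × (Fin 3 → ℝ) => H q.1 q.2) ∧
    (∀ x, H 0 x = x) ∧
    ∃ φ : ℝ → ℝ, Continuous φ ∧ StrictMono φ ∧
      (∀ t, φ (t + 2 * Real.pi) = φ t + 2 * Real.pi) ∧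
      ∀ t : ℝ, H 1 (K.curve (t : Real.Angle)) = K'.curve (φ t : Real.Angle)

/-- The curve winding `a` times around the axis of the standard torus and `b` times around
its core (so that positive `a`, `b` give the right-handed torus knot). -/
noncomputable def torusCurve (a b : ℤ) (θ : Real.Angle) : Fin 3 → ℝ :=
  ![(2 + (b • θ).cos) * (a • θ).cos, (2 + (b • θ).cos) * (a • θ).sin, -(b • θ).sin]

theorem torusCurve_coe (a b : ℤ) (t : ℝ) : torusCurve a b (t : Real.Angle) =
    ![(2 + Real.cos (b * t)) * Real.cos (a * t), (2 + Real.cos (b * t)) * Real.sin (a * t),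
      -Real.sin (b * t)] := by
  have h : ∀ n : ℤ, n • (t : Real.Angle) = ((n * t : ℝ) : Real.Angle) := by
    intro n
    rw [← Real.Angle.coe_zsmul, zsmul_eq_mul]
  simp only [torusCurve, h, Real.Angle.cos_coe, Real.Angle.sin_coe]

theorem torusCurve_smooth (a b : ℤ) :
    ContDiff ℝ ∞ (fun t : ℝ => torusCurve a b (t : Real.Angle)) := by
  simp only [torusCurve_coe]
  rw [contDiff_pi]
  intro i
  fin_cases i <;> simp <;> fun_prop

theorem angle_eq_of_cos_sin {θ φ : Real.Angle} (hc : θ.cos = φ.cos) (hs : θ.sin = φ.sin) :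
    θ = φ := by
  induction θ using Real.Angle.induction_on with
  | _ x =>
    induction φ using Real.Angle.induction_on with
    | _ y => exact Real.Angle.cos_sin_inj hc hs

theorem torusCurve_injective {a b : ℤ} (h : IsCoprime a b) :
    Function.Injective (torusCurve a b) := by
  intro θ φ e
  have e0 := congrFun e 0
  have e1 := congrFun e 1
  have e2 := congrFun e 2
  simp only [torusCurve, Matrix.cons_val_zero, Matrix.cons_val_one, Matrix.cons_val] at e0 e1 e2
  have p1 : ∀ ψ : Real.Angle, 0 < 2 + ψ.cos := by
    intro ψ
    induction ψ using Real.Angle.induction_on with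
    | _ x => simp only [Real.Angle.cos_coe]; linarith [Real.neg_one_le_cos x]
  have sq : (2 + (b • θ).cos) ^ 2 = (2 + (b • φ).cos) ^ 2 := by
    have h1 := Real.Angle.cos_sq_add_sin_sq (a • θ)
    have h2 := Real.Angle.cos_sq_add_sin_sq (a • φ)
    calc (2 + (b • θ).cos) ^ 2
        = ((2 + (b • θ).cos) * (a • θ).cos) ^ 2 + ((2 + (b • θ).cos) * (a • θ).sin) ^ 2 := by
          linear_combination (-(2 + (b • θ).cos) ^ 2) * h1
      _ = ((2 + (b • φ).cos) * (a • φ).cos) ^ 2 + ((2 + (b • φ).cos) * (a • φ).sin) ^ 2 := by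
          rw [e0, e1]
      _ = _ := by linear_combination ((2 + (b • φ).cos) ^ 2) * h2
  have r : 2 + (b • θ).cos = 2 + (b • φ).cos :=
    (pow_left_inj₀ (p1 _).le (p1 _).le two_ne_zero).1 sq
  have hb : b • θ = b • φ := angle_eq_of_cos_sin (by linarith) (by linarith)
  rw [r] at e0 e1
  have ha : a • θ = a • φ := angle_eq_of_cos_sin
    (mul_left_cancel₀ (p1 _).ne' e0) (mul_left_cancel₀ (p1 _).ne' e1)
  obtain ⟨u, v, huv⟩ := h
  calc θ = (u * a + v * b) • θ := by rw [huv, one_zsmul]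
    _ = (u * a + v * b) • φ := by rw [add_zsmul, add_zsmul, mul_zsmul, mul_zsmul, mul_zsmul,
          mul_zsmul, ha, hb]
    _ = φ := by rw [huv, one_zsmul]

theorem torusCurve_velocity (a b : ℤ) (t : ℝ) : curveVelocity (torusCurve a b) (t : Real.Angle) =
    ![-(b * Real.sin (b * t)) * Real.cos (a * t) - (2 + Real.cos (b * t)) * (a * Real.sin (a * t)),
      -(b * Real.sin (b * t)) * Real.sin (a * t) + (2 + Real.cos (b * t)) * (a * Real.cos (a * t)),
      -(b * Real.cos (b * t))] := by
  have key : HasDerivAt (fun s : ℝ => torusCurve a b ((t : Real.Angle) + (s : Real.Angle)))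
      ![-(b * Real.sin (b * t)) * Real.cos (a * t)
          - (2 + Real.cos (b * t)) * (a * Real.sin (a * t)),
        -(b * Real.sin (b * t)) * Real.sin (a * t)
          + (2 + Real.cos (b * t)) * (a * Real.cos (a * t)),
        -(b * Real.cos (b * t))] 0 := by
    have l : ∀ n : ℤ, HasDerivAt (fun s : ℝ => (n : ℝ) * (t + s)) (n : ℝ) 0 := by
      intro n
      simpa using ((hasDerivAt_id (0 : ℝ)).const_add t).const_mul (n : ℝ)
    have c := fun n : ℤ => (l n).cos
    have s := fun n : ℤ => (l n).sin
    simp only [add_zero] at c s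
    simp only [← Real.Angle.coe_add, torusCurve_coe]
    rw [hasDerivAt_pi]
    intro i
    fin_cases i
    · refine (((c b).const_add 2).mul (c a)).congr_deriv ?_
      simp
      ring
    · refine (((c b).const_add 2).mul (s a)).congr_deriv ?_
      simp
      ring
    · refine (s b).neg.congr_deriv ?_
      simp
      ring
  exact key.deriv

theorem torusCurve_regular {a b : ℤ} (h : IsCoprime a b) (θ : Real.Angle) :
    curveVelocity (torusCurve a b) θ ≠ 0 := by
  induction θ using Real.Angle.induction_on with
  | _ t =>
    rw [torusCurve_velocity]
    intro e
    have e0 := congrFun e 0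
    have e1 := congrFun e 1
    have e2 := congrFun e 2
    simp only [Matrix.cons_val_zero, Matrix.cons_val_one, Matrix.cons_val, Pi.zero_apply]
      at e0 e1 e2
    have ha := Real.sin_sq_add_cos_sq (a * t)
    have hb := Real.sin_sq_add_cos_sq (b * t)
    have r : (b : ℝ) * Real.sin (b * t) = 0 := by
      linear_combination (-Real.cos (a * t)) * e0 - Real.sin (a * t) * e1
        - (b : ℝ) * Real.sin (b * t) * ha
    have w : (2 + Real.cos (b * t)) * (a : ℝ) = 0 := by
      linear_combination (-Real.sin (a * t)) * e0 + Real.cos (a * t) * e1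
        - (2 + Real.cos (b * t)) * (a : ℝ) * ha
    have b0 : (b : ℝ) ^ 2 = 0 := by
      linear_combination (b : ℝ) * Real.sin (b * t) * r - (b : ℝ) * Real.cos (b * t) * e2
        - (b : ℝ) ^ 2 * hb
    have a0 : (a : ℝ) = 0 := by
      rcases mul_eq_zero.1 w with w | w
      · linarith [Real.neg_one_le_cos (b * t)]
      · exact w
    have a1 : a = 0 := by exact_mod_cast a0
    have b1 : b = 0 := by exact_mod_cast pow_eq_zero_iff two_ne_zero |>.1 b0
    obtain ⟨u, v, huv⟩ := h
    simp [a1, b1] at huv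

/-- The torus knot `T_{a,b}`, for coprime integers `a` and `b`. -/
noncomputable def torusKnot (a b : ℤ) (h : IsCoprime a b) : Knot where
  curve := torusCurve a b
  smooth := torusCurve_smooth a b
  regular := torusCurve_regular h
  injective := torusCurve_injective h

/-- The projection of a knot to the plane of the first two coordinates. -/
def Knot.shadow (K : Knot) (θ : Real.Angle) : ℝ × ℝ := (K.curve θ 0, K.curve θ 1)

/-- The knot passes at the parameter `u` under the point with parameter `o`. -/
def Knot.PassesUnder (K : Knot) (u o : Real.Angle) : Prop :=
  K.shadow u = K.shadow o ∧ K.curve u 2 < K.curve o 2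

/-- A crossing of the projection, as the pair of its lower and its upper parameter. -/
def Knot.Crossing (K : Knot) : Type :=
  {q : Real.Angle × Real.Angle // K.PassesUnder q.1 q.2}

/-- The lower parameter of a crossing. -/
def Knot.Crossing.under {K : Knot} (c : K.Crossing) : Real.Angle := c.1.1

/-- The upper parameter of a crossing. -/
def Knot.Crossing.over {K : Knot} (c : K.Crossing) : Real.Angle := c.1.2

/-- The determinant of the projected velocities of the upper and of the lower strand: it is
positive at a positive crossing and negative at a negative crossing. -/
noncomputable def Knot.Crossing.orientation {K : Knot} (c : K.Crossing) : ℝ :=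
  curveVelocity K.curve c.over 0 * curveVelocity K.curve c.under 1 -
    curveVelocity K.curve c.over 1 * curveVelocity K.curve c.under 0

/-- A knot diagram: a knot in general position with respect to the projection, which is an
immersion whose only singularities are finitely many transverse double points. The heights record
which strand of a crossing is the upper one. -/
structure KnotDiagram extends Knot where
  immersed : ∀ θ, curveVelocity curve θ 0 ≠ 0 ∨ curveVelocity curve θ 1 ≠ 0
  finite_crossings : Finite toKnot.Crossing
  transverse : ∀ c : toKnot.Crossing, c.orientation ≠ 0
  no_triple : ∀ θ φ ψ, toKnot.shadow θ = toKnot.shadow φ → toKnot.shadow φ = toKnot.shadow ψ →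
    θ = φ ∨ φ = ψ ∨ θ = ψ

namespace KnotDiagram

/-- `D` is a diagram of the knot `K`. -/
def IsDiagramOf (D : KnotDiagram) (K : Knot) : Prop := D.toKnot.Equivalent K

/-- `θ` is the parameter of an undercrossing. -/
def IsUnder (D : KnotDiagram) (θ : Real.Angle) : Prop := ∃ o, D.PassesUnder θ o

/-- `θ` is the parameter of an overcrossing. -/
def IsOver (D : KnotDiagram) (θ : Real.Angle) : Prop := ∃ u, D.PassesUnder u θ

/-- The arcs of a diagram: the connected components of the circle cut at the undercrossings. -/
def Arc (D : KnotDiagram) : Type := ConnectedComponents {θ : Real.Angle // ¬ D.IsUnder θ}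

/-- The arc that contains a given point of the circle other than an undercrossing. -/
noncomputable def arcAt (D : KnotDiagram) (θ : Real.Angle) (h : ¬ D.IsUnder θ) : D.Arc :=
  ConnectedComponents.mk (⟨θ, h⟩ : {θ : Real.Angle // ¬ D.IsUnder θ})

theorem not_isUnder_over (D : KnotDiagram) (c : D.Crossing) : ¬ D.IsUnder c.over := by
  rintro ⟨o, ho⟩
  have hc : D.PassesUnder c.under c.over := c.2
  rcases D.no_triple c.under c.over o hc.1 ho.1 with e | e | e
  · exact absurd hc.2 (by rw [e]; exact lt_irrefl _)
  · exact absurd ho.2 (by rw [e]; exact lt_irrefl _)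
  · exact absurd (hc.2.trans ho.2) (by rw [e]; exact lt_irrefl _)

/-- The over-arc of a crossing. -/
noncomputable def overArc (D : KnotDiagram) (c : D.Crossing) : D.Arc := D.arcAt c.over (D.not_isUnder_over c)

/-- `a` is the incoming under-arc of the crossing `c`. -/
def IsIncoming (D : KnotDiagram) (c : D.Crossing) (a : D.Arc) : Prop :=
  ∀ᶠ s : ℝ in 𝓝[>] 0, ∃ h, D.arcAt (c.under - (s : Real.Angle)) h = a

/-- `a` is the outgoing under-arc of the crossing `c`. -/
def IsOutgoing (D : KnotDiagram) (c : D.Crossing) (a : D.Arc) : Prop :=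
  ∀ᶠ s : ℝ in 𝓝[>] 0, ∃ h, D.arcAt (c.under + (s : Real.Angle)) h = a

/-- The diagram is alternating: along the knot, between two overcrossings there is an
undercrossing and between two undercrossings there is an overcrossing. -/
def IsAlternating (D : KnotDiagram) : Prop :=
  ∀ s t : ℝ, s < t →
    (D.IsUnder s → D.IsUnder t → ∃ r ∈ Set.Ioo s t, D.IsOver (r : Real.Angle)) ∧
    (D.IsOver s → D.IsOver t → ∃ r ∈ Set.Ioo s t, D.IsUnder (r : Real.Angle))

/-- A crossing is nugatory if the removal of the crossing point disconnects the projection. -/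
def IsNugatory (D : KnotDiagram) (c : D.Crossing) : Prop :=
  ¬ IsPreconnected (Set.range D.shadow \ {D.shadow c.under})

/-- The diagram is reduced: it has no nugatory crossing. -/
def IsReduced (D : KnotDiagram) : Prop := ∀ c : D.Crossing, ¬ D.IsNugatory c

/-- The operation `x * y = m x + (1 - m) y` of the linear Alexander quandle `Λ_{n,m}`. -/
def quandleOp {n : ℕ} (m : ℤ) (x y : ZMod n) : ZMod n := m * x + (1 - m) * y

/-- Colorings of a diagram by `Λ_{n,m}`, for coprime `n` and `m`. If a crossing has over-arc `y`,
incoming under-arc `x` and outgoing under-arc `z`, then `z = x * y` at a positive crossing, and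
`z = x *⁻¹ y`, that is `x = z * y`, at a negative crossing. -/
def IsColoring (D : KnotDiagram) {n : ℕ} (m : ℤ) (C : D.Arc → ZMod n) : Prop :=
  ∀ (c : D.Crossing) (a a' : D.Arc), D.IsIncoming c a → D.IsOutgoing c a' →
    (0 < c.orientation → C a' = quandleOp m (C a) (C (D.overArc c))) ∧
    (c.orientation < 0 → C a = quandleOp m (C a') (C (D.overArc c)))

open Classical in
/-- The Alexander matrix of a diagram over `ℤ[t, t⁻¹]`: the row of a crossing is the coloring
condition `t x + (1 - t) y - z = 0` (positive crossing) or `t z + (1 - t) y - x = 0`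
(negative crossing). -/
noncomputable def alexanderMatrix (D : KnotDiagram) :
    Matrix D.Crossing D.Arc (LaurentPolynomial ℤ) := fun c a =>
  (if 0 < c.orientation then
      (if D.IsIncoming c a then LaurentPolynomial.T 1 else 0) -
        (if D.IsOutgoing c a then 1 else 0)
    else
      (if D.IsOutgoing c a then LaurentPolynomial.T 1 else 0) -
        (if D.IsIncoming c a then 1 else 0)) +
    (if D.overArc c = a then 1 - LaurentPolynomial.T 1 else 0)

end KnotDiagram

/-- `f` is the reduced Alexander polynomial of the knot `K`: up to a unit `± t ^ j`, it is the
determinant of the Alexander matrix of any diagram of `K` with one row and one column deleted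
(the matrix is square, except that a diagram without crossings has no row and one column), and it
is normalised to be a polynomial with positive constant coefficient. -/
def Knot.IsReducedAlexander (K : Knot) (f : Polynomial ℤ) : Prop :=
  0 < f.coeff 0 ∧ ∀ D : KnotDiagram, D.IsDiagramOf K →
    ∀ (k : ℕ) (r : Fin k ↪ D.Crossing) (s : Fin k ↪ D.Arc), k + 1 = Nat.card D.Arc →
      Associated (D.alexanderMatrix.submatrix r s).det (Polynomial.toLaurent f)

open Classical in
/-- The reduced Alexander polynomial `Δ⁰_K` of the knot `K`. -/
noncomputable def Knot.reducedAlexander (K : Knot) : Polynomial ℤ :=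
  if h : ∃ f, K.IsReducedAlexander f then h.choose else 0

/-- The knot `K` displays Kauffman-Harary behavior mod `(p, m)`. -/
def Knot.DisplaysKH (K : Knot) (p : ℕ) (m : ℤ) : Prop :=
  p.Prime ∧ 1 < m ∧ m < p ∧ K.reducedAlexander.eval m = p ∧
    ∃ D : KnotDiagram, D.IsDiagramOf K ∧ D.IsReduced ∧ D.IsAlternating ∧
      ∃ C : D.Arc → ZMod p, D.IsColoring m C ∧ (∃ a a', C a ≠ C a') ∧ Function.Injective C

/-! The projection of the standard curve is already the required diagram. Double points pair `θ`
with `θ + π`. The lower strand has `bθ = π/2` and the upper one `bθ = -π/2`, so there are `|b|`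
crossings, all of the sign of `b`, and they alternate. Number undercrossings and arcs by `ℤ/b` and
put `b = 2h + 1`. The crossing `k` has under-arcs `k - 1` and `k` and over-arc `k + h`. Multiplying
indices by `2`, the inverse of `-h`, turns every crossing into the same relation `yᵢ = t yᵢ₋₂ + (1 -
t) yᵢ₋₁`, whatever the sign of `b`.

The solution with `y₀ = 0`, `y₁ = 1` is the alternating sum `Sᵢ(t) = 1 - t + ⋯ + (-t)^(i-1)`. It
computes the minor of the Alexander matrix (`det_recursion_matrix`), whence `Δ⁰ = S_n` with `n =
|b|`. It also gives the coloring `i ↦ Sᵢ(m)` mod `p = S_n(m)`. This is well defined because `(-m)^n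
≡ 1` mod `p` (`altGeomSum_periodic`). It is injective because `S_j - S_i = (-m)^i S_{j-i}`, where `1
< m < p` and `0 < |S_{j-i}| < p` (`altGeomSum_cast_ne`).

Invariance of the Alexander polynomial is not needed: its default value `0` would not be prime at
`m`, so the hypothesis supplies existence, and the one diagram determines the value. -/

/-! ### Double points of the standard projection -/

theorem odd_of_isCoprime_two {b : ℤ} (hb : IsCoprime (2 : ℤ) b) : Odd b := by
  by_contra h
  obtain ⟨c, rfl⟩ := Int.not_odd_iff_even.1 h
  obtain ⟨u, v, huv⟩ := hb
  have : 2 * (u + v * c) = 1 := by linear_combination huv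
  omega

theorem Real.Angle.odd_zsmul_coe_pi {b : ℤ} (hb : Odd b) :
    b • (Real.pi : Real.Angle) = Real.pi := by
  obtain ⟨h, rfl⟩ := hb
  rw [add_zsmul, one_zsmul, mul_comm, mul_zsmul, Real.Angle.two_zsmul_coe_pi, zsmul_zero, zero_add]

theorem Real.Angle.eq_pi_div_two_of_sin_eq_one {θ : Real.Angle} (h : θ.sin = 1) :
    θ = ((Real.pi / 2 : ℝ) : Real.Angle) := by
  have h1 := Real.Angle.cos_sq_add_sin_sq θ
  have h2 : θ.cos = 0 := by
    rw [h] at h1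
    exact pow_eq_zero_iff two_ne_zero |>.1 (by linarith)
  exact angle_eq_of_cos_sin (by simp [h2]) (by simp [h])

theorem two_add_cos_pos (θ : Real.Angle) : 0 < 2 + θ.cos := by
  induction θ using Real.Angle.induction_on with
  | _ x => simp only [Real.Angle.cos_coe]; linarith [Real.neg_one_le_cos x]

/-- In polar coordinates the shadow has radius `2 + cos (bθ) > 0` and angle `aθ`, and a nonzero
point of the plane determines both. -/
theorem torusKnot_shadow_eq {a b : ℤ} {h : IsCoprime a b} {θ φ : Real.Angle}
    (e : (torusKnot a b h).shadow θ = (torusKnot a b h).shadow φ) :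
    a • θ = a • φ ∧ (b • θ).cos = (b • φ).cos := by
  have e0 := congrArg Prod.fst e
  have e1 := congrArg Prod.snd e
  simp only [Knot.shadow, torusKnot, torusCurve, Matrix.cons_val_zero, Matrix.cons_val_one]
    at e0 e1
  have sq : (2 + (b • θ).cos) ^ 2 = (2 + (b • φ).cos) ^ 2 := by
    have h1 := Real.Angle.cos_sq_add_sin_sq (a • θ)
    have h2 := Real.Angle.cos_sq_add_sin_sq (a • φ)
    calc (2 + (b • θ).cos) ^ 2
        = ((2 + (b • θ).cos) * (a • θ).cos) ^ 2 + ((2 + (b • θ).cos) * (a • θ).sin) ^ 2 := by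
          linear_combination (-(2 + (b • θ).cos) ^ 2) * h1
      _ = ((2 + (b • φ).cos) * (a • φ).cos) ^ 2 + ((2 + (b • φ).cos) * (a • φ).sin) ^ 2 := by
          rw [e0, e1]
      _ = _ := by linear_combination ((2 + (b • φ).cos) ^ 2) * h2
  have r : 2 + (b • θ).cos = 2 + (b • φ).cos :=
    (pow_left_inj₀ (two_add_cos_pos _).le (two_add_cos_pos _).le two_ne_zero).1 sq
  rw [r] at e0 e1
  exact ⟨angle_eq_of_cos_sin (mul_left_cancel₀ (two_add_cos_pos _).ne' e0)
    (mul_left_cancel₀ (two_add_cos_pos _).ne' e1), by linarith⟩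

theorem torusKnot_two_shadow_eq {b : ℤ} {hb : IsCoprime 2 b} {θ φ : Real.Angle}
    (e : (torusKnot 2 b hb).shadow θ = (torusKnot 2 b hb).shadow φ) :
    θ = φ ∨ θ = φ + (Real.pi : Real.Angle) :=
  Real.Angle.two_zsmul_eq_iff.1 (torusKnot_shadow_eq e).1

/-- As `b` is odd, passing from `θ` to `θ + π` negates both `cos (bθ)` and `sin (bθ)`. Equal radii
force `cos (bθ) = 0`, and since the height is `-sin (bθ)`, the lower strand is the one with sine
`1`. -/
theorem torusKnot_two_passesUnder_iff {b : ℤ} {hb : IsCoprime 2 b} {u o : Real.Angle} :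
    (torusKnot 2 b hb).PassesUnder u o ↔
      o = u + (Real.pi : Real.Angle) ∧ b • u = ((Real.pi / 2 : ℝ) : Real.Angle) := by
  have hodd := Real.Angle.odd_zsmul_coe_pi (odd_of_isCoprime_two hb)
  constructor
  · rintro ⟨e, hlt⟩
    rcases torusKnot_two_shadow_eq e with rfl | rfl
    · exact absurd hlt (lt_irrefl _)
    · refine ⟨by rw [add_assoc, Real.Angle.coe_pi_add_coe_pi, add_zero], ?_⟩
      have hc := (torusKnot_shadow_eq e).2
      simp only [torusKnot, torusCurve, Matrix.cons_val, zsmul_add, hodd, Real.Angle.cos_add_pi,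
        Real.Angle.sin_add_pi] at hc hlt ⊢
      rw [← hodd, ← zsmul_add]
      apply Real.Angle.eq_pi_div_two_of_sin_eq_one
      rw [zsmul_add, hodd, Real.Angle.sin_add_pi]
      have h1 := Real.Angle.cos_sq_add_sin_sq (b • o)
      have h0 : (b • o).cos = 0 := by linarith
      rw [h0] at h1
      have : ((b • o).sin + 1) * ((b • o).sin - 1) = 0 := by linear_combination h1
      rcases mul_eq_zero.1 this with h | h <;> linarith
  · rintro ⟨rfl, h⟩
    have h2 : (2 : ℤ) • (u + (Real.pi : Real.Angle)) = (2 : ℤ) • u := by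
      rw [zsmul_add, Real.Angle.two_zsmul_coe_pi, add_zero]
    refine ⟨?_, ?_⟩
    · simp only [Knot.shadow, torusKnot, torusCurve, Matrix.cons_val_zero, Matrix.cons_val_one, h2]
      simp [hodd, h]
    · simp only [torusKnot, torusCurve, Matrix.cons_val, zsmul_add, hodd, h]
      simp

/-- Both strands have the same polar angle. In the radial and tangential frame the upper velocity is
`(b, 4)` and the lower one `(-b, 4)`, with determinant `8b`. -/
theorem torusKnot_two_orientation {b : ℤ} {hb : IsCoprime 2 b} (c : (torusKnot 2 b hb).Crossing) :
    c.orientation = 8 * b := by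
  obtain ⟨⟨u, o⟩, hc⟩ := c
  obtain ⟨ho, hu⟩ := torusKnot_two_passesUnder_iff.1 hc
  obtain ⟨h, rfl⟩ := odd_of_isCoprime_two hb
  simp only at ho hu
  subst ho
  induction u using Real.Angle.induction_on with
  | _ x =>
    rw [← Real.Angle.intCast_mul_eq_zsmul] at hu
    have hs : Real.sin (((2 * h + 1 : ℤ) : ℝ) * x) = 1 := by
      rw [← Real.Angle.sin_coe, hu]; simp
    have hc : Real.cos (((2 * h + 1 : ℤ) : ℝ) * x) = 0 := by
      rw [← Real.Angle.cos_coe, hu]; simp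
    have e1 : ((2 * h + 1 : ℤ) : ℝ) * (x + Real.pi) =
        (((2 * h + 1 : ℤ) : ℝ) * x + Real.pi) + h * (2 * Real.pi) := by push_cast; ring
    have e2 : ((2 : ℤ) : ℝ) * (x + Real.pi) = ((2 : ℤ) : ℝ) * x + 2 * Real.pi := by push_cast; ring
    have hsq := Real.sin_sq_add_cos_sq (((2 : ℤ) : ℝ) * x)
    simp only [Knot.Crossing.orientation, Knot.Crossing.under, Knot.Crossing.over, torusKnot,
      ← Real.Angle.coe_add, torusCurve_velocity, Matrix.cons_val_zero, Matrix.cons_val_one, e1, e2,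
      Real.cos_add_int_mul_two_pi, Real.sin_add_int_mul_two_pi, Real.cos_add_pi, Real.sin_add_pi,
      Real.cos_add_two_pi, Real.sin_add_two_pi, hs, hc]
    push_cast at hsq ⊢
    linear_combination (8 * (2 * (h : ℝ) + 1)) * hsq

/-! ### Coordinates with undercrossings at the integers -/

/-- The parameter with coordinate `s` on the torus knot `T_{2,b}`: the integral coordinates are
those of the undercrossings, and `s` and `s + b` have the same parameter. -/
noncomputable def torusParam (b : ℤ) (s : ℝ) : Real.Angle :=
  ((Real.pi / 2 + 2 * Real.pi * s) / b : ℝ)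

theorem continuous_torusParam (b : ℤ) : Continuous (torusParam b) :=
  Real.Angle.continuous_coe.comp (by fun_prop)

theorem exists_torusParam_eq {b : ℤ} (hb : b ≠ 0) (θ : Real.Angle) : ∃ s, torusParam b s = θ := by
  have hb' : (b : ℝ) ≠ 0 := Int.cast_ne_zero.2 hb
  induction θ using Real.Angle.induction_on with
  | _ x =>
    refine ⟨(b * x - Real.pi / 2) / (2 * Real.pi), ?_⟩
    rw [torusParam]
    congr 1
    field_simp
    ring

theorem torusParam_eq_iff {b : ℤ} (hb : b ≠ 0) {s t : ℝ} :
    torusParam b s = torusParam b t ↔ ∃ k : ℤ, s - t = b * k := by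
  have hb' : (b : ℝ) ≠ 0 := Int.cast_ne_zero.2 hb
  rw [torusParam, torusParam, Real.Angle.angle_eq_iff_two_pi_dvd_sub]
  refine exists_congr fun k => ?_
  have hpi := Real.pi_ne_zero
  rw [← sub_div, div_eq_iff hb']
  constructor
  · intro h
    have : 2 * Real.pi * (s - t) = 2 * Real.pi * (b * k) := by linear_combination h
    exact mul_left_cancel₀ (by positivity) this
  · intro h
    linear_combination (2 * Real.pi) * h

theorem zsmul_torusParam {b : ℤ} (hb : b ≠ 0) (s : ℝ) :
    b • torusParam b s = ((Real.pi / 2 + 2 * Real.pi * s : ℝ) : Real.Angle) := by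
  have hb' : (b : ℝ) ≠ 0 := Int.cast_ne_zero.2 hb
  rw [torusParam, ← Real.Angle.intCast_mul_eq_zsmul]
  congr 1
  field_simp

theorem zsmul_torusParam_eq_pi_div_two_iff {b : ℤ} (hb : b ≠ 0) (s : ℝ) :
    b • torusParam b s = ((Real.pi / 2 : ℝ) : Real.Angle) ↔ ∃ k : ℤ, s = k := by
  rw [zsmul_torusParam hb, Real.Angle.angle_eq_iff_two_pi_dvd_sub]
  refine exists_congr fun k => ?_
  have hpi := Real.pi_ne_zero
  constructor
  · intro h
    have : 2 * Real.pi * s = 2 * Real.pi * k := by linear_combination h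
    exact mul_left_cancel₀ (by positivity) this
  · rintro rfl
    ring

theorem torusParam_add_coe {b : ℤ} (hb : b ≠ 0) (s x : ℝ) :
    torusParam b s + (x : Real.Angle) = torusParam b (s + b * x / (2 * Real.pi)) := by
  have hb' : (b : ℝ) ≠ 0 := Int.cast_ne_zero.2 hb
  rw [torusParam, torusParam, ← Real.Angle.coe_add]
  congr 1
  field_simp
  ring

theorem torusParam_sub_coe {b : ℤ} (hb : b ≠ 0) (s x : ℝ) :
    torusParam b s - (x : Real.Angle) = torusParam b (s - b * x / (2 * Real.pi)) := by
  rw [sub_eq_add_neg, ← Real.Angle.coe_neg, torusParam_add_coe hb]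
  congr 1
  ring

theorem torusParam_add_pi {b : ℤ} (hb : b ≠ 0) (s : ℝ) :
    torusParam b s + (Real.pi : Real.Angle) = torusParam b (s + b / 2) := by
  rw [torusParam_add_coe hb]
  congr 1
  field_simp

theorem ne_zero_of_isCoprime_two {b : ℤ} (hb : IsCoprime (2 : ℤ) b) : b ≠ 0 := by
  obtain ⟨h, rfl⟩ := odd_of_isCoprime_two hb
  omega

/-- The crossing of `T_{2,b}` whose lower parameter has coordinate `k`. -/
noncomputable def torusCrossing (b : ℤ) (hb : IsCoprime 2 b) (k : ℤ) :
    (torusKnot 2 b hb).Crossing :=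
  ⟨(torusParam b k, torusParam b k + (Real.pi : Real.Angle)), torusKnot_two_passesUnder_iff.2
    ⟨rfl, (zsmul_torusParam_eq_pi_div_two_iff (ne_zero_of_isCoprime_two hb) _).2 ⟨k, rfl⟩⟩⟩

theorem torusCrossing_eq_iff {b : ℤ} {hb : IsCoprime 2 b} {k l : ℤ} :
    torusCrossing b hb k = torusCrossing b hb l ↔ b ∣ k - l := by
  have h0 := ne_zero_of_isCoprime_two hb
  have h1 : torusCrossing b hb k = torusCrossing b hb l ↔ torusParam b k = torusParam b l :=
    ⟨fun h => congrArg Knot.Crossing.under h, fun h => Subtype.ext (by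
      simp only [torusCrossing, h])⟩
  rw [h1, torusParam_eq_iff h0]
  exact exists_congr fun j => by exact_mod_cast Iff.rfl

theorem torusCrossing_surjective {b : ℤ} {hb : IsCoprime 2 b} :
    Function.Surjective (torusCrossing b hb) := by
  rintro ⟨⟨u, o⟩, hc⟩
  obtain ⟨ho, hu⟩ := torusKnot_two_passesUnder_iff.1 hc
  simp only at ho hu
  obtain ⟨s, rfl⟩ := exists_torusParam_eq (ne_zero_of_isCoprime_two hb) u
  obtain ⟨k, rfl⟩ := (zsmul_torusParam_eq_pi_div_two_iff (ne_zero_of_isCoprime_two hb) _).1 hu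
  refine ⟨k, ?_⟩
  subst ho
  rfl

theorem finite_torusCrossing (b : ℤ) (hb : IsCoprime 2 b) :
    Finite (torusKnot 2 b hb).Crossing := by
  refine Finite.of_surjective (fun i : Finset.Ico (0 : ℤ) |b| => torusCrossing b hb i) fun c => ?_
  obtain ⟨k, rfl⟩ := torusCrossing_surjective c
  have h0 := ne_zero_of_isCoprime_two hb
  refine ⟨⟨k % b, Finset.mem_Ico.2 ⟨Int.emod_nonneg _ h0, Int.emod_lt_abs _ h0⟩⟩, ?_⟩
  rw [torusCrossing_eq_iff]
  exact ⟨-(k / b), by linear_combination Int.emod_add_mul_ediv k b⟩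

/-! ### The diagram and its alternation -/

/-- The projection of the standard torus knot `T_{2,b}`. -/
noncomputable abbrev torusDiagram (b : ℤ) (hb : IsCoprime 2 b) : KnotDiagram where
  toKnot := torusKnot 2 b hb
  immersed := by
    intro θ
    induction θ using Real.Angle.induction_on with
    | _ t =>
      by_contra! h
      obtain ⟨e0, e1⟩ := h
      simp only [torusKnot, torusCurve_velocity, Matrix.cons_val_zero, Matrix.cons_val_one]
        at e0 e1
      have ha := Real.sin_sq_add_cos_sq (((2 : ℤ) : ℝ) * t)
      have w : (2 + Real.cos (b * t)) * ((2 : ℤ) : ℝ) = 0 := by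
        linear_combination (-Real.sin (((2 : ℤ) : ℝ) * t)) * e0 +
          Real.cos (((2 : ℤ) : ℝ) * t) * e1 - (2 + Real.cos (b * t)) * ((2 : ℤ) : ℝ) * ha
      push_cast at w
      linarith [Real.neg_one_le_cos (b * t)]
  finite_crossings := finite_torusCrossing b hb
  transverse := by
    intro c
    rw [torusKnot_two_orientation]
    exact mul_ne_zero (by norm_num) (Int.cast_ne_zero.2 (ne_zero_of_isCoprime_two hb))
  no_triple := by
    intro θ φ ψ h1 h2
    rcases torusKnot_two_shadow_eq h1 with h | h
    · exact Or.inl h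
    rcases torusKnot_two_shadow_eq h2 with h' | h'
    · exact Or.inr (Or.inl h')
    · exact Or.inr (Or.inr (by
        rw [h, h', add_assoc, Real.Angle.coe_pi_add_coe_pi, add_zero]))

theorem Knot.Equivalent.refl (K : Knot) : K.Equivalent K :=
  ⟨fun _ => Homeomorph.refl _, continuous_snd, fun _ => rfl, id, continuous_id, strictMono_id,
    fun _ => rfl, fun _ => rfl⟩

theorem torusDiagram_isDiagramOf (b : ℤ) (hb : IsCoprime 2 b) :
    (torusDiagram b hb).IsDiagramOf (torusKnot 2 b hb) :=
  Knot.Equivalent.refl _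

theorem torusDiagram_isUnder_iff {b : ℤ} {hb : IsCoprime 2 b} {θ : Real.Angle} :
    (torusDiagram b hb).IsUnder θ ↔ b • θ = ((Real.pi / 2 : ℝ) : Real.Angle) :=
  ⟨fun ⟨_, h⟩ => ((torusKnot_two_passesUnder_iff (hb := hb)).1 h).2,
    fun h => ⟨_, (torusKnot_two_passesUnder_iff (hb := hb)).2 ⟨rfl, h⟩⟩⟩

theorem torusDiagram_isOver_iff {b : ℤ} {hb : IsCoprime 2 b} {θ : Real.Angle} :
    (torusDiagram b hb).IsOver θ ↔
      b • θ = ((Real.pi / 2 : ℝ) : Real.Angle) + (Real.pi : Real.Angle) := by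
  have hodd := Real.Angle.odd_zsmul_coe_pi (odd_of_isCoprime_two hb)
  constructor
  · rintro ⟨u, h⟩
    obtain ⟨rfl, hu⟩ := (torusKnot_two_passesUnder_iff (hb := hb)).1 h
    rw [zsmul_add, hu, hodd]
  · intro h
    refine ⟨θ + (Real.pi : Real.Angle), (torusKnot_two_passesUnder_iff (hb := hb)).2 ⟨?_, ?_⟩⟩ <;>
    simp only [zsmul_add, h, hodd, add_assoc, Real.Angle.coe_pi_add_coe_pi, add_zero]

theorem torusDiagram_isUnder_param_iff {b : ℤ} {hb : IsCoprime 2 b} {s : ℝ} :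
    (torusDiagram b hb).IsUnder (torusParam b s) ↔ ∃ k : ℤ, s = k := by
  rw [torusDiagram_isUnder_iff,
    zsmul_torusParam_eq_pi_div_two_iff (ne_zero_of_isCoprime_two hb)]

theorem exists_zsmul_add_pi_between {b : ℤ} (hb : b ≠ 0) {s t : ℝ} (hst : s < t)
    (h : b • (s : Real.Angle) = b • (t : Real.Angle)) :
    ∃ r ∈ Set.Ioo s t, b • (r : Real.Angle) = b • (s : Real.Angle) + (Real.pi : Real.Angle) := by
  have hb' : (b : ℝ) ≠ 0 := Int.cast_ne_zero.2 hb
  have hpi := Real.pi_pos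
  -- Over a length `π / |b|` the angle `bθ` changes by `±π`, the same modulo `2π`, while `t - s` is
  -- a positive multiple of `2π / |b|`.
  refine ⟨s + Real.pi / |(b : ℝ)|, ⟨by have : 0 < Real.pi / |(b : ℝ)| := by positivity
                                       linarith, ?_⟩, ?_⟩
  · rw [← Real.Angle.intCast_mul_eq_zsmul, ← Real.Angle.intCast_mul_eq_zsmul,
      Real.Angle.angle_eq_iff_two_pi_dvd_sub] at h
    obtain ⟨k, hk⟩ := h
    have hk0 : k ≠ 0 := by
      rintro rfl
      have : (b : ℝ) * (s - t) = 0 := by linear_combination hk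
      rcases mul_eq_zero.1 this with h | h
      · exact hb' h
      · linarith
    have h1 : (1 : ℝ) ≤ |(k : ℝ)| := by exact_mod_cast Int.one_le_abs hk0
    have h2 : |(b : ℝ)| * (t - s) = 2 * Real.pi * |(k : ℝ)| := by
      have := congrArg abs hk
      rwa [← mul_sub, abs_mul, abs_mul, abs_sub_comm, abs_of_pos (sub_pos.2 hst),
        abs_of_pos (show 0 < 2 * Real.pi by positivity)] at this
    have : Real.pi / |(b : ℝ)| < t - s := by
      rw [div_lt_iff₀ (abs_pos.2 hb')]
      nlinarith
    linarith
  · rw [Real.Angle.coe_add, zsmul_add]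
    congr 1
    rw [← Real.Angle.intCast_mul_eq_zsmul]
    rcases lt_or_gt_of_ne hb' with h | h
    · rw [abs_of_neg h, show (b : ℝ) * (Real.pi / -b) = -Real.pi by field_simp,
        Real.Angle.coe_neg, Real.Angle.neg_coe_pi]
    · rw [abs_of_pos h, show (b : ℝ) * (Real.pi / b) = Real.pi by field_simp]

theorem torusDiagram_isAlternating (b : ℤ) (hb : IsCoprime 2 b) :
    (torusDiagram b hb).IsAlternating := by
  intro s t hst
  simp only [torusDiagram_isUnder_iff, torusDiagram_isOver_iff]
  constructor <;> intro hs ht <;>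
  obtain ⟨r, hr, e⟩ := exists_zsmul_add_pi_between (ne_zero_of_isCoprime_two hb) hst
    (hs.trans ht.symm)
  · exact ⟨r, hr, by rw [e, hs]⟩
  · exact ⟨r, hr, by rw [e, hs, add_assoc, Real.Angle.coe_pi_add_coe_pi, add_zero]⟩

/-! ### Arcs and their incidence with crossings -/

theorem KnotDiagram.arcAt_congr (D : KnotDiagram) {θ φ : Real.Angle} (e : θ = φ)
    (h : ¬ D.IsUnder θ) : D.arcAt θ h = D.arcAt φ (e ▸ h) := by
  subst e
  rfl

/-- Since `𝓝[>] 0` is nontrivial, an eventual value is unique; exhibiting one incoming or outgoing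
arc therefore identifies it. -/
theorem KnotDiagram.eventually_arcAt_eq_iff (D : KnotDiagram) {f : ℝ → Real.Angle} {a₀ : D.Arc}
    (h₀ : ∀ᶠ s : ℝ in 𝓝[>] 0, ∃ h, D.arcAt (f s) h = a₀) (a : D.Arc) :
    (∀ᶠ s : ℝ in 𝓝[>] 0, ∃ h, D.arcAt (f s) h = a) ↔ a₀ = a := by
  constructor
  · intro h
    obtain ⟨s, ⟨h1, e1⟩, ⟨h2, e2⟩⟩ := (h₀.and h).exists
    exact e1.symm.trans e2
  · rintro rfl
    exact h₀

theorem not_isUnder_torusParam {b : ℤ} {hb : IsCoprime 2 b} {s : ℝ} (k : ℤ) (h1 : (k : ℝ) < s)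
    (h2 : s < k + 1) : ¬ (torusDiagram b hb).IsUnder (torusParam b s) := by
  rw [torusDiagram_isUnder_param_iff]
  rintro ⟨l, rfl⟩
  have h1' : k < l := by exact_mod_cast h1
  have h2' : l < k + 1 := by exact_mod_cast h2
  omega

/-- The arc of `T_{2,b}` from the undercrossing with coordinate `k` to the one with `k + 1`. -/
noncomputable def torusArc (b : ℤ) (hb : IsCoprime 2 b) (k : ℤ) : (torusDiagram b hb).Arc :=
  (torusDiagram b hb).arcAt (torusParam b (k + 1 / 2))
    (not_isUnder_torusParam k (by linarith) (by linarith))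

theorem arcAt_torusParam {b : ℤ} {hb : IsCoprime 2 b} {s : ℝ} (k : ℤ) (h1 : (k : ℝ) < s)
    (h2 : s < k + 1) (h : ¬ (torusDiagram b hb).IsUnder (torusParam b s)) :
    (torusDiagram b hb).arcAt (torusParam b s) h = torusArc b hb k := by
  let f : Set.Ioo (k : ℝ) (k + 1) → {θ : Real.Angle // ¬ (torusDiagram b hb).IsUnder θ} :=
    fun t => ⟨torusParam b t, not_isUnder_torusParam k t.2.1 t.2.2⟩
  have hf : Continuous f :=
    ((continuous_torusParam b).comp continuous_subtype_val).subtype_mk _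
  have : PreconnectedSpace (Set.Ioo (k : ℝ) (k + 1)) :=
    Subtype.preconnectedSpace isPreconnected_Ioo
  refine ConnectedComponents.coe_eq_coe'.2 ?_
  exact (isPreconnected_range hf).subset_connectedComponent
    ⟨⟨k + 1 / 2, by linarith, by linarith⟩, rfl⟩ ⟨⟨s, h1, h2⟩, rfl⟩

theorem torusArc_surjective {b : ℤ} {hb : IsCoprime 2 b} :
    Function.Surjective (torusArc b hb) := by
  intro a
  obtain ⟨⟨θ, h⟩, rfl⟩ := ConnectedComponents.surjective_coe a
  obtain ⟨s, rfl⟩ := exists_torusParam_eq (ne_zero_of_isCoprime_two hb) θ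
  refine ⟨⌊s⌋, (arcAt_torusParam ⌊s⌋ (lt_of_le_of_ne (Int.floor_le s) fun e => h ?_)
    (Int.lt_floor_add_one s) h).symm⟩
  exact torusDiagram_isUnder_param_iff.2 ⟨_, e.symm⟩

/-- The integral part of the coordinate of a parameter of `T_{2,b}`, modulo `b`. -/
noncomputable def torusIndex (b : ℤ) (hb : b ≠ 0) (θ : Real.Angle) : ZMod b.natAbs :=
  (⌊(exists_torusParam_eq hb θ).choose⌋ : ℤ)

theorem torusIndex_torusParam {b : ℤ} (hb : b ≠ 0) (s : ℝ) :
    torusIndex b hb (torusParam b s) = (⌊s⌋ : ℤ) := by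
  obtain ⟨k, hk⟩ := (torusParam_eq_iff hb).1 (exists_torusParam_eq hb (torusParam b s)).choose_spec
  rw [torusIndex, eq_add_of_sub_eq' hk, ← Int.cast_mul, Int.floor_add_intCast,
    ZMod.intCast_eq_intCast_iff_dvd_sub, Int.natAbs_dvd]
  exact ⟨-k, by ring⟩

theorem isOpenMap_torusParam {b : ℤ} (hb : b ≠ 0) : IsOpenMap (torusParam b) := by
  have hb' : (b : ℝ) ≠ 0 := Int.cast_ne_zero.2 hb
  have h1 : IsOpenMap (Real.Angle.coe) := QuotientAddGroup.isOpenMap_coe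
  have e : torusParam b = Real.Angle.coe ∘ (Homeomorph.addLeft (Real.pi / 2 / b)) ∘
      (Homeomorph.mulLeft₀ (2 * Real.pi / b) (by positivity)) := by
    funext s
    simp only [torusParam, Function.comp, Homeomorph.coe_addLeft, Homeomorph.coe_mulLeft₀]
    congr 1
    field_simp
  rw [e]
  exact h1.comp ((Homeomorph.isOpenMap _).comp (Homeomorph.isOpenMap _))

/-- This invariant separates the arcs: away from the undercrossings the coordinate is not an
integer, so its floor is locally constant, and changing the coordinate by a multiple of `b` does not
affect it modulo `b`. -/
theorem isLocallyConstant_torusIndex {b : ℤ} (hb : IsCoprime 2 b) :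
    IsLocallyConstant fun θ : {θ : Real.Angle // ¬ (torusDiagram b hb).IsUnder θ} =>
      torusIndex b (ne_zero_of_isCoprime_two hb) θ := by
  have h0 := ne_zero_of_isCoprime_two hb
  rw [IsLocallyConstant.iff_eventually_eq]
  rintro ⟨θ, h⟩
  obtain ⟨s, rfl⟩ := exists_torusParam_eq h0 θ
  have hs : s ∈ Set.Ioo (⌊s⌋ : ℝ) (⌊s⌋ + 1) :=
    ⟨lt_of_le_of_ne (Int.floor_le s) fun e => h (torusDiagram_isUnder_param_iff.2 ⟨_, e.symm⟩),
      Int.lt_floor_add_one s⟩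
  have hn : torusParam b '' Set.Ioo (⌊s⌋ : ℝ) (⌊s⌋ + 1) ∈ 𝓝 (torusParam b s) :=
    (isOpenMap_torusParam h0 _ isOpen_Ioo).mem_nhds ⟨s, hs, rfl⟩
  filter_upwards [continuous_subtype_val.continuousAt.preimage_mem_nhds hn]
  rintro ⟨φ, h'⟩ ⟨t, ht, e⟩
  simp only at e
  subst e
  simp only [torusIndex_torusParam]
  rw [Int.floor_eq_iff.2 ⟨ht.1.le, ht.2⟩]

theorem torusArc_eq_iff {b : ℤ} {hb : IsCoprime 2 b} {k l : ℤ} :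
    torusArc b hb k = torusArc b hb l ↔ b ∣ k - l := by
  have h0 := ne_zero_of_isCoprime_two hb
  have hfl : ∀ j : ℤ, ⌊(j : ℝ) + 1 / 2⌋ = j := fun j =>
    Int.floor_eq_iff.2 ⟨by linarith, by linarith⟩
  constructor
  · intro h
    have h1 := ConnectedComponents.coe_eq_coe'.1 h
    have h2 := (isLocallyConstant_torusIndex hb).apply_eq_of_isPreconnected
      isPreconnected_connectedComponent h1 mem_connectedComponent
    simp only [torusIndex_torusParam, hfl] at h2
    rw [ZMod.intCast_eq_intCast_iff_dvd_sub, Int.natAbs_dvd] at h2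
    rwa [dvd_sub_comm]
  · rintro ⟨j, hj⟩
    refine KnotDiagram.arcAt_congr _ ((torusParam_eq_iff h0).2 ⟨j, ?_⟩) _
    have : (k : ℝ) - l = b * j := by exact_mod_cast hj
    linarith

theorem eventually_arcAt_right {b : ℤ} (hb : IsCoprime 2 b) (k : ℤ) {δ : ℝ} (hδ : 0 < δ) :
    ∀ᶠ s : ℝ in 𝓝[>] 0, ∃ h, (torusDiagram b hb).arcAt (torusParam b (k + δ * s)) h =
      torusArc b hb k := by
  filter_upwards [Ioo_mem_nhdsGT (show (0 : ℝ) < 1 / δ by positivity)] with s hs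
  have h1 : 0 < δ * s := mul_pos hδ hs.1
  have h2 : δ * s < 1 := by rw [mul_comm]; exact (lt_div_iff₀ hδ).1 hs.2
  exact ⟨not_isUnder_torusParam k (by linarith) (by linarith),
    arcAt_torusParam k (by linarith) (by linarith) _⟩

theorem eventually_arcAt_left {b : ℤ} (hb : IsCoprime 2 b) (k : ℤ) {δ : ℝ} (hδ : δ < 0) :
    ∀ᶠ s : ℝ in 𝓝[>] 0, ∃ h, (torusDiagram b hb).arcAt (torusParam b (k + δ * s)) h =
      torusArc b hb (k - 1) := by
  have hδ' : 0 < -δ := neg_pos.2 hδ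
  filter_upwards [Ioo_mem_nhdsGT (show (0 : ℝ) < 1 / -δ by positivity)] with s hs
  have h1 : 0 < -δ * s := mul_pos hδ' hs.1
  have h2 : -δ * s < 1 := by rw [mul_comm]; exact (lt_div_iff₀ hδ').1 hs.2
  exact ⟨not_isUnder_torusParam (k - 1) (by push_cast; linarith) (by push_cast; linarith),
    arcAt_torusParam (k - 1) (by push_cast; linarith) (by push_cast; linarith) _⟩

theorem torusCrossing_under_add {b : ℤ} (hb : IsCoprime 2 b) (k : ℤ) (s : ℝ) :
    (torusCrossing b hb k).under + (s : Real.Angle) =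
      torusParam b (k + b / (2 * Real.pi) * s) := by
  refine (torusParam_add_coe (ne_zero_of_isCoprime_two hb) _ _).trans ?_
  congr 1
  ring

theorem torusCrossing_under_sub {b : ℤ} (hb : IsCoprime 2 b) (k : ℤ) (s : ℝ) :
    (torusCrossing b hb k).under - (s : Real.Angle) =
      torusParam b (k + -(b / (2 * Real.pi)) * s) := by
  refine (torusParam_sub_coe (ne_zero_of_isCoprime_two hb) _ _).trans ?_
  congr 1
  ring

theorem isIncoming_torusCrossing_iff_of_pos {b : ℤ} {hb : IsCoprime 2 b} (h : 0 < b) (k : ℤ)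
    (a : (torusDiagram b hb).Arc) :
    (torusDiagram b hb).IsIncoming (torusCrossing b hb k) a ↔ torusArc b hb (k - 1) = a := by
  have hb' : (0 : ℝ) < b := Int.cast_pos.2 h
  have := Real.pi_pos
  refine KnotDiagram.eventually_arcAt_eq_iff _ ?_ a
  simp only [torusCrossing_under_sub]
  exact eventually_arcAt_left hb k (neg_neg_of_pos (by positivity))

theorem isOutgoing_torusCrossing_iff_of_pos {b : ℤ} {hb : IsCoprime 2 b} (h : 0 < b) (k : ℤ)
    (a : (torusDiagram b hb).Arc) :
    (torusDiagram b hb).IsOutgoing (torusCrossing b hb k) a ↔ torusArc b hb k = a := by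
  have hb' : (0 : ℝ) < b := Int.cast_pos.2 h
  have := Real.pi_pos
  refine KnotDiagram.eventually_arcAt_eq_iff _ ?_ a
  simp only [torusCrossing_under_add]
  exact eventually_arcAt_right hb k (by positivity)

/-- For negative `b` the coordinate decreases along the knot, which exchanges the incoming and
outgoing arcs. -/
theorem isIncoming_torusCrossing_iff_of_neg {b : ℤ} {hb : IsCoprime 2 b} (h : b < 0) (k : ℤ)
    (a : (torusDiagram b hb).Arc) :
    (torusDiagram b hb).IsIncoming (torusCrossing b hb k) a ↔ torusArc b hb k = a := by
  have hb' : (b : ℝ) < 0 := Int.cast_lt_zero.2 h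
  have := Real.pi_pos
  refine KnotDiagram.eventually_arcAt_eq_iff _ ?_ a
  simp only [torusCrossing_under_sub]
  exact eventually_arcAt_right hb k (neg_pos.2 (div_neg_of_neg_of_pos hb' (by positivity)))

theorem isOutgoing_torusCrossing_iff_of_neg {b : ℤ} {hb : IsCoprime 2 b} (h : b < 0) (k : ℤ)
    (a : (torusDiagram b hb).Arc) :
    (torusDiagram b hb).IsOutgoing (torusCrossing b hb k) a ↔ torusArc b hb (k - 1) = a := by
  have hb' : (b : ℝ) < 0 := Int.cast_lt_zero.2 h
  have := Real.pi_pos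
  refine KnotDiagram.eventually_arcAt_eq_iff _ ?_ a
  simp only [torusCrossing_under_add]
  exact eventually_arcAt_left hb k (div_neg_of_neg_of_pos hb' (by positivity))

/-- The upper parameter lies `b / 2 = h + 1/2` further on, exactly at the midpoint of an arc. -/
theorem overArc_torusCrossing {b : ℤ} {hb : IsCoprime 2 b} {h : ℤ} (e : b = 2 * h + 1) (k : ℤ) :
    (torusDiagram b hb).overArc (torusCrossing b hb k) = torusArc b hb (k + h) := by
  refine KnotDiagram.arcAt_congr _ ?_ _
  refine (torusParam_add_pi (ne_zero_of_isCoprime_two hb) _).trans ?_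
  congr 1
  rw [e]
  push_cast
  ring

/-! ### Uniform form of the crossing relations -/

/-- The arcs of `T_{2,2h+1}`, ordered so that the over-arc of a crossing lies between its two
under-arcs. -/
noncomputable def torusStrand (b : ℤ) (hb : IsCoprime 2 b) (h i : ℤ) : (torusDiagram b hb).Arc :=
  torusArc b hb (-(h * i))

/-- Modulo `b`, `-h` is invertible with inverse `2`, because `-2h = 1 - b`. -/
theorem dvd_neg_mul_sub_iff {b h i j : ℤ} (e : b = 2 * h + 1) :
    b ∣ -(h * i) - -(h * j) ↔ b ∣ i - j := by
  subst e
  constructor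
  · rintro ⟨c, hc⟩
    exact ⟨i - j + 2 * c, by linear_combination 2 * hc⟩
  · rintro ⟨c, hc⟩
    exact ⟨-(h * c), by linear_combination (-h) * hc⟩

theorem torusStrand_eq_iff {b : ℤ} {hb : IsCoprime 2 b} {h i j : ℤ} (e : b = 2 * h + 1) :
    torusStrand b hb h i = torusStrand b hb h j ↔ b ∣ i - j :=
  torusArc_eq_iff.trans (dvd_neg_mul_sub_iff e)

theorem torusCrossing_neg_mul_eq_iff {b : ℤ} {hb : IsCoprime 2 b} {h i j : ℤ}
    (e : b = 2 * h + 1) :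
    torusCrossing b hb (-(h * i)) = torusCrossing b hb (-(h * j)) ↔ b ∣ i - j :=
  torusCrossing_eq_iff.trans (dvd_neg_mul_sub_iff e)

theorem exists_torusStrand_eq {b : ℤ} {hb : IsCoprime 2 b} {h : ℤ} (e : b = 2 * h + 1)
    (a : (torusDiagram b hb).Arc) : ∃ i : ℕ, i < b.natAbs ∧ torusStrand b hb h i = a := by
  have h0 := ne_zero_of_isCoprime_two hb
  obtain ⟨k, rfl⟩ := torusArc_surjective a
  have hn := Int.emod_nonneg (2 * k) h0
  refine ⟨((2 * k) % b).toNat, ?_, torusArc_eq_iff.2 ?_⟩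
  · have := Int.emod_lt_abs (2 * k) h0
    rw [← Int.natCast_natAbs] at this
    omega
  · rw [Int.toNat_of_nonneg hn, Int.emod_def]
    exact ⟨h * (2 * k / b) - k, by linear_combination k * e⟩

theorem exists_torusCrossing_eq {b : ℤ} {hb : IsCoprime 2 b} {h : ℤ} (e : b = 2 * h + 1)
    (c : (torusDiagram b hb).Crossing) :
    ∃ i : ℕ, torusCrossing b hb (-(h * (i + 2 : ℕ))) = c := by
  have h0 := ne_zero_of_isCoprime_two hb
  obtain ⟨k, rfl⟩ := torusCrossing_surjective (hb := hb) c
  have hn := Int.emod_nonneg (2 * k - 2) h0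
  -- The crossing `k` has new index `2k`. It is written as `i + 2` so that the three strands `i`, `i
  -- + 1`, `i + 2` have natural indices.
  refine ⟨((2 * k - 2) % b).toNat, torusCrossing_eq_iff.2 ?_⟩
  rw [Nat.cast_add, Int.toNat_of_nonneg hn, Int.emod_def]
  exact ⟨h * ((2 * k - 2) / b) - k, by push_cast; linear_combination k * e⟩

theorem torusStrand_sub_two {b : ℤ} {hb : IsCoprime 2 b} {h : ℤ} (e : b = 2 * h + 1) (i : ℤ) :
    torusArc b hb (-(h * i) - 1) = torusStrand b hb h (i - 2) :=
  torusArc_eq_iff.2 ⟨-1, by linear_combination e⟩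

theorem torusStrand_sub_one {b : ℤ} {hb : IsCoprime 2 b} {h : ℤ} (e : b = 2 * h + 1) (i : ℤ) :
    (torusDiagram b hb).overArc (torusCrossing b hb (-(h * i))) = torusStrand b hb h (i - 1) := by
  rw [overArc_torusCrossing e, torusStrand]
  congr 1
  ring

open Classical in
-- A negative `b` reverses both the sign of the crossings and the direction of travel. The two
-- reversals cancel, leaving one formula.
theorem torusDiagram_alexanderMatrix_apply {b : ℤ} {hb : IsCoprime 2 b} {h : ℤ}
    (e : b = 2 * h + 1) (i : ℤ) (a : (torusDiagram b hb).Arc) :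
    (torusDiagram b hb).alexanderMatrix (torusCrossing b hb (-(h * i))) a =
      (if torusStrand b hb h (i - 2) = a then LaurentPolynomial.T 1 else 0) -
        (if torusStrand b hb h i = a then 1 else 0) +
        (if torusStrand b hb h (i - 1) = a then 1 - LaurentPolynomial.T 1 else 0) := by
  have ho : (torusCrossing b hb (-(h * i))).orientation = 8 * b :=
    torusKnot_two_orientation (hb := hb) _
  unfold KnotDiagram.alexanderMatrix
  rcases lt_or_gt_of_ne (ne_zero_of_isCoprime_two hb) with hs | hs
  · have hb' : (b : ℝ) < 0 := Int.cast_lt_zero.2 hs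
    simp only [isIncoming_torusCrossing_iff_of_neg hs, isOutgoing_torusCrossing_iff_of_neg hs,
      torusStrand_sub_two e, torusStrand_sub_one e]
    rw [if_neg (by rw [ho]; linarith)]
    rfl
  · have hb' : (0 : ℝ) < b := Int.cast_pos.2 hs
    simp only [isIncoming_torusCrossing_iff_of_pos hs, isOutgoing_torusCrossing_iff_of_pos hs,
      torusStrand_sub_two e, torusStrand_sub_one e]
    rw [if_pos (by rw [ho]; linarith)]
    rfl

theorem torusDiagram_isColoring {b : ℤ} {hb : IsCoprime 2 b} {h : ℤ} (e : b = 2 * h + 1) {n : ℕ}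
    (m : ℤ) (C : (torusDiagram b hb).Arc → ZMod n)
    (hC : ∀ i : ℕ, C (torusStrand b hb h (i + 2 : ℕ)) =
      m * C (torusStrand b hb h i) + (1 - m) * C (torusStrand b hb h (i + 1 : ℕ))) :
    (torusDiagram b hb).IsColoring m C := by
  intro c a a' hin hout
  have ho : c.orientation = 8 * b := torusKnot_two_orientation (hb := hb) c
  obtain ⟨i, rfl⟩ := exists_torusCrossing_eq e c
  have h1 := torusStrand_sub_one (hb := hb) e (i + 2 : ℕ)
  have h2 := torusStrand_sub_two (hb := hb) e (i + 2 : ℕ)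
  rw [show ((i + 2 : ℕ) : ℤ) - 1 = (i + 1 : ℕ) by push_cast; ring] at h1
  rw [show ((i + 2 : ℕ) : ℤ) - 2 = i by push_cast; ring] at h2
  rw [h1, ho]
  rcases lt_or_gt_of_ne (ne_zero_of_isCoprime_two hb) with hs | hs
  · have hb' : (b : ℝ) < 0 := Int.cast_lt_zero.2 hs
    rw [isIncoming_torusCrossing_iff_of_neg hs] at hin
    rw [isOutgoing_torusCrossing_iff_of_neg hs, h2] at hout
    subst hin hout
    exact ⟨fun h => by linarith, fun _ => hC i⟩
  · have hb' : (0 : ℝ) < b := Int.cast_pos.2 hs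
    rw [isIncoming_torusCrossing_iff_of_pos hs, h2] at hin
    rw [isOutgoing_torusCrossing_iff_of_pos hs] at hout
    subst hin hout
    exact ⟨fun _ => hC i, fun h => by linarith⟩

theorem card_torusDiagram_arc {b : ℤ} (hb : IsCoprime 2 b) :
    Nat.card (torusDiagram b hb).Arc = b.natAbs := by
  obtain ⟨h, e⟩ := odd_of_isCoprime_two hb
  rw [← Nat.card_fin b.natAbs]
  refine (Nat.card_congr (Equiv.ofBijective
    (fun i : Fin b.natAbs => torusStrand b hb h (i : ℕ)) ⟨fun i j hij => ?_, fun a => ?_⟩)).symm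
  · have h1 := Int.eq_zero_of_abs_lt_dvd ((abs_dvd _ _).2 ((torusStrand_eq_iff e).1 hij)) (by
      have := i.2; have := j.2; rw [abs_lt, ← Int.natCast_natAbs b]; omega)
    ext
    omega
  · obtain ⟨i, hi, ha⟩ := exists_torusStrand_eq e a
    exact ⟨⟨i, hi⟩, ha⟩

/-! ### Absence of nugatory crossings -/

/-- Without the crossing point the projection is the union of the images of two open half-periods.
Each is connected, and they meet at another crossing, which exists once `|b| ≥ 3`. -/
theorem torusDiagram_isReduced {b : ℤ} (hb : IsCoprime 2 b) (h3 : 3 ≤ |b|) :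
    (torusDiagram b hb).IsReduced := by
  intro c hc
  apply hc
  clear hc
  obtain ⟨⟨u, o⟩, hc⟩ := c
  obtain ⟨-, hu⟩ := (torusKnot_two_passesUnder_iff (hb := hb)).1 hc
  simp only [Knot.Crossing.under] at hu ⊢
  clear hc
  have h0 := ne_zero_of_isCoprime_two hb
  have hb' : (b : ℝ) ≠ 0 := Int.cast_ne_zero.2 h0
  have hpi := Real.pi_pos
  induction u using Real.Angle.induction_on with
  | _ x =>
  set f : ℝ → ℝ × ℝ := fun t => (torusDiagram b hb).shadow (t : Real.Angle) with hf
  have hfc : Continuous f := by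
    have := (torusKnot 2 b hb).smooth.continuous
    exact ((continuous_apply 0).comp this).prodMk ((continuous_apply 1).comp this)
  have hpass : ∀ t : ℝ, b • (t : Real.Angle) = ((Real.pi / 2 : ℝ) : Real.Angle) →
      f t = f (t + Real.pi) := by
    intro t ht
    have := ((torusKnot_two_passesUnder_iff (hb := hb)).2 ⟨rfl, ht⟩).1
    rwa [← Real.Angle.coe_add] at this
  have hne : ∀ t, x < t → t < x + 2 * Real.pi → t ≠ x + Real.pi → f t ≠ f x := by
    intro t h1 h2 h3 e
    rcases torusKnot_two_shadow_eq (hb := hb) e with h | h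
    · obtain ⟨k, hk⟩ := Real.Angle.angle_eq_iff_two_pi_dvd_sub.1 h
      have k0 : (0 : ℝ) < k := by
        by_contra! hk0
        nlinarith
      have k1 : (k : ℝ) < 1 := by
        by_contra! hk1
        nlinarith
      norm_cast at k0 k1
      omega
    · rw [← Real.Angle.coe_add] at h
      obtain ⟨k, hk⟩ := Real.Angle.angle_eq_iff_two_pi_dvd_sub.1 h
      have k0 : (-1 : ℝ) < k := by
        by_contra! hk0
        nlinarith
      have k1 : (k : ℝ) < 1 := by
        by_contra! hk1
        nlinarith
      norm_cast at k0 k1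
      obtain rfl : k = 0 := by omega
      simp at hk
      exact h3 (by linarith)
  have hset : Set.range (torusDiagram b hb).shadow \ {(torusDiagram b hb).shadow x} =
      f '' Set.Ioo x (x + Real.pi) ∪ f '' Set.Ioo (x + Real.pi) (x + 2 * Real.pi) := by
    ext q
    constructor
    · rintro ⟨⟨θ, rfl⟩, hq⟩
      induction θ using Real.Angle.induction_on with
      | _ y =>
        have ht := toIcoMod_mem_Ico Real.two_pi_pos x y
        have e := Real.Angle.coe_toIcoMod y x
        set t := toIcoMod Real.two_pi_pos x y
        rw [← e] at hq ⊢
        have ne1 : x ≠ t := fun h => hq (by rw [← h]; rfl)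
        have ne2 : t ≠ x + Real.pi := fun h => hq (by rw [h]; exact (hpass x hu).symm)
        rcases lt_or_gt_of_ne ne2 with h | h
        · exact Or.inl ⟨t, ⟨lt_of_le_of_ne ht.1 ne1, h⟩, rfl⟩
        · exact Or.inr ⟨t, ⟨h, ht.2⟩, rfl⟩
    · rintro (⟨t, ht, rfl⟩ | ⟨t, ht, rfl⟩)
      · exact ⟨⟨_, rfl⟩, hne t ht.1 (by linarith [ht.2]) ht.2.ne⟩
      · exact ⟨⟨_, rfl⟩, hne t (by linarith [ht.1]) ht.2 ht.1.ne'⟩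
  rw [hset]
  have hB : (3 : ℝ) ≤ |(b : ℝ)| := by exact_mod_cast h3
  -- The neighbouring undercrossing; `|b| ≥ 3` places it before `x + π`, so its upper parameter `y +
  -- π` lies in the other half-period.
  set y := x + 2 * Real.pi / |(b : ℝ)| with hy
  have hy0 : 0 < 2 * Real.pi / |(b : ℝ)| := by positivity
  have hy1 : 2 * Real.pi / |(b : ℝ)| < Real.pi := by
    rw [div_lt_iff₀ (by linarith)]
    nlinarith
  have hyb : b • (y : Real.Angle) = ((Real.pi / 2 : ℝ) : Real.Angle) := by
    rw [hy, Real.Angle.coe_add, zsmul_add, hu, add_eq_left, ← Real.Angle.intCast_mul_eq_zsmul]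
    rcases lt_or_gt_of_ne hb' with h | h
    · rw [abs_of_neg h, show (b : ℝ) * (2 * Real.pi / -b) = -(2 * Real.pi) by field_simp,
        Real.Angle.coe_neg, Real.Angle.coe_two_pi, neg_zero]
    · rw [abs_of_pos h, show (b : ℝ) * (2 * Real.pi / b) = 2 * Real.pi by field_simp,
        Real.Angle.coe_two_pi]
  refine IsPreconnected.union (f y) ⟨y, ⟨by linarith, by linarith⟩, rfl⟩
    ⟨y + Real.pi, ⟨by linarith, by linarith⟩, (hpass y hyb).symm⟩
    (isPreconnected_Ioo.image _ hfc.continuousOn) (isPreconnected_Ioo.image _ hfc.continuousOn)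

/-! ### Alternating geometric sums -/

/-- The alternating geometric sum `1 - x + x² - ⋯` with `n` terms. -/
def altGeomSum {R : Type*} [CommRing R] (x : R) (n : ℕ) : R :=
  ∑ j ∈ Finset.range n, (-x) ^ j

section altGeomSum

variable {R : Type*} [CommRing R] (x : R)

theorem altGeomSum_zero : altGeomSum x 0 = 0 := by simp [altGeomSum]

theorem altGeomSum_one : altGeomSum x 1 = 1 := by simp [altGeomSum]

theorem altGeomSum_succ (n : ℕ) : altGeomSum x (n + 1) = altGeomSum x n + (-x) ^ n := by
  rw [altGeomSum, Finset.sum_range_succ, altGeomSum]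

theorem altGeomSum_succ' (n : ℕ) : altGeomSum x (n + 1) = 1 - x * altGeomSum x n := by
  rw [altGeomSum, Finset.sum_range_succ', altGeomSum, Finset.mul_sum, pow_zero, sub_eq_add_neg,
    ← Finset.sum_neg_distrib, add_comm]
  congr 1
  exact Finset.sum_congr rfl fun j _ => by ring

/-- The crossing relation: each increment of the sequence is `-x` times the preceding one. -/
theorem altGeomSum_add_two (n : ℕ) :
    altGeomSum x (n + 2) = x * altGeomSum x n + (1 - x) * altGeomSum x (n + 1) := by
  rw [altGeomSum_succ, altGeomSum_succ]
  ring

theorem one_add_mul_altGeomSum (n : ℕ) : (1 + x) * altGeomSum x n = 1 - (-x) ^ n := by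
  linear_combination (altGeomSum_succ' x n) - (altGeomSum_succ x n)

theorem altGeomSum_add (k n : ℕ) :
    altGeomSum x (k + n) = altGeomSum x k + (-x) ^ k * altGeomSum x n := by
  induction n with
  | zero => simp [altGeomSum_zero]
  | succ n ih => rw [← add_assoc, altGeomSum_succ, ih, altGeomSum_succ, pow_add]; ring

theorem map_altGeomSum {S : Type*} [CommRing S] (φ : R →+* S) (n : ℕ) :
    φ (altGeomSum x n) = altGeomSum (φ x) n := by
  simp [altGeomSum]

end altGeomSum

/-! ### The Alexander polynomial -/

/-- The determinant of the circulant matrix of the recursion `t yᵢ₋₂ + (1 - t) yᵢ₋₁ - yᵢ = 0`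
of period `k + 3`, with one row and one column deleted. -/
theorem det_recursion_matrix {R : Type*} [CommRing R] (t : R) (k : ℕ)
    (M : Matrix (Fin (k + 2)) (Fin (k + 2)) R)
    (hM : ∀ i j : Fin (k + 2), M i j =
      (if (i : ℕ) = j + 2 ∨ ((i : ℕ) = 0 ∧ (j : ℕ) = k + 1) then t else 0) -
        (if (i : ℕ) = j then 1 else 0) + (if (i : ℕ) = j + 1 then 1 - t else 0)) :
    M.det = (-1) ^ k * altGeomSum t (k + 3) := by
  -- Column `0` is replaced by the combination of columns with weights `S₁, S₂, …`; its own weight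
  -- is `S₁ = 1`, so the determinant is unchanged. The recursion, with `S₀ = 0` on the deleted
  -- strand, kills every row but the first, where the wrap-around entry leaves `t S_{k+2} - 1 =
  -- -S_{k+3}`.
  have hdet := Matrix.det_updateCol_sum M 0 fun i => altGeomSum t ((i : ℕ) + 1)
  have hcol : (fun i => ∑ j : Fin (k + 2), altGeomSum t ((j : ℕ) + 1) • M i j) =
      Pi.single 0 (-altGeomSum t (k + 3)) := by
    funext i
    have h1 : ∑ j : Fin (k + 2), altGeomSum t ((j : ℕ) + 1) • M i j =
        ∑ j ∈ Finset.range (k + 2), ((if (i : ℕ) = j + 2 ∨ ((i : ℕ) = 0 ∧ j = k + 1)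
            then altGeomSum t (j + 1) * t else 0) -
          (if (i : ℕ) = j then altGeomSum t (j + 1) else 0) +
          (if (i : ℕ) = j + 1 then altGeomSum t (j + 1) * (1 - t) else 0)) := by
      rw [← Fin.sum_univ_eq_sum_range]
      refine Finset.sum_congr rfl fun j _ => ?_
      rw [hM]
      simp only [smul_eq_mul, mul_add, mul_sub, mul_ite, mul_zero, mul_one]
    rw [h1, Finset.sum_add_distrib, Finset.sum_sub_distrib]
    obtain ⟨i, hi⟩ := i
    rcases i with _ | _ | i
    · simp [altGeomSum_one, altGeomSum_succ' t (k + 2)]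
      ring
    · rw [Pi.single_eq_of_ne (by simp)]
      simp [altGeomSum_succ' t 1, altGeomSum_one]
    · rw [Pi.single_eq_of_ne (by simp [Fin.ext_iff])]
      have h2 : i < k + 2 := by omega
      have h3 : i + 1 < k + 2 := by omega
      simp [h2, h3, hi, altGeomSum_add_two t (i + 1)]
      ring
  rw [hcol] at hdet
  simp only [Fin.val_zero, zero_add, altGeomSum_one, one_smul] at hdet
  -- Only the top entry of the new column survives; its minor is lower triangular with diagonal
  -- `-1`.
  rw [← hdet, Matrix.det_succ_column_zero, Fin.sum_univ_succ, Finset.sum_eq_zero, add_zero]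
  · have hlow : ((M.updateCol 0 (Pi.single 0 (-altGeomSum t (k + 3)))).submatrix
        (Fin.succAbove 0) Fin.succ).det = (-1) ^ (k + 1) := by
      have hN : ∀ i j : Fin (k + 1), ((M.updateCol 0
          (Pi.single 0 (-altGeomSum t (k + 3)))).submatrix (Fin.succAbove 0) Fin.succ) i j = M i.succ j.succ := fun i j => by simp
      rw [Matrix.det_of_isLowerTriangular]
      · rw [Finset.prod_congr rfl fun i _ => show _ = (-1 : R) by rw [hN, hM]; simp]
        simp
      · intro i j hij
        have hij' : i < j := hij
        rw [hN, hM]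
        have h : (i : ℕ) < j := hij'
        simp only [Fin.val_succ]
        rw [if_neg (by omega), if_neg (by omega), if_neg (by omega)]
        simp
    rw [hlow]
    simp
    ring
  · intro i _
    simp

open Polynomial in
/-- A polynomial with positive constant coefficient is determined by its class up to units of the
ring of Laurent polynomials. -/
theorem eq_of_associated_toLaurent {f g : ℤ[X]} (hf : 0 < f.coeff 0) (hg : 0 < g.coeff 0)
    (h : Associated (toLaurent g) (toLaurent f)) : f = g := by
  obtain ⟨u, hu⟩ := h
  -- Clearing denominators in `u` and `u⁻¹` gives polynomials whose product is a power of the prime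
  -- `X`, so `U`, and hence `u`, is a monomial with coefficient `±1`.
  obtain ⟨a, U, hU⟩ := LaurentPolynomial.exists_T_pow (u : LaurentPolynomial ℤ)
  obtain ⟨c, W, hW⟩ := LaurentPolynomial.exists_T_pow
    ((u⁻¹ : (LaurentPolynomial ℤ)ˣ) : LaurentPolynomial ℤ)
  have hUW : U * W = X ^ (a + c) := by
    apply toLaurent_injective
    rw [map_mul, hU, hW, toLaurent_X_pow, Nat.cast_add, LaurentPolynomial.T_add]
    linear_combination (LaurentPolynomial.T (a : ℤ) * LaurentPolynomial.T (c : ℤ)) * u.mul_inv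
  have hfU : f * X ^ a = g * U := by
    apply toLaurent_injective
    rw [map_mul, map_mul, hU, toLaurent_X_pow, ← hu, mul_assoc]
  obtain ⟨j, -, v, hv⟩ := (dvd_prime_pow prime_X _).1 (Dvd.intro _ hUW)
  obtain ⟨w, hw⟩ : ∃ w : ℤˣ, U = X ^ j * C (w : ℤ) := by
    obtain ⟨r, ⟨w, rfl⟩, hr⟩ := Polynomial.isUnit_iff.1 (v⁻¹).isUnit
    exact ⟨w, by rw [hr, ← hv, mul_assoc, Units.mul_inv, mul_one]⟩
  have key : f * X ^ a = g * C (w : ℤ) * X ^ j := by rw [hfU, hw]; ring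
  have hgw : (g * C (w : ℤ)).coeff 0 ≠ 0 := by
    rw [coeff_mul_C]
    exact mul_ne_zero hg.ne' w.ne_zero
  -- Both constant coefficients are nonzero, so no power of `X` can be left over on either side.
  have haj : a = j := by
    rcases lt_trichotomy a j with h | h | h
    · obtain ⟨d, rfl⟩ := Nat.exists_eq_add_of_lt h
      have h1 : f = g * C (w : ℤ) * X ^ (d + 1) := by
        apply mul_right_cancel₀ (pow_ne_zero a (X_ne_zero (R := ℤ)))
        rw [key]
        ring
      rw [h1] at hf
      simp at hf
    · exact h
    · obtain ⟨d, rfl⟩ := Nat.exists_eq_add_of_lt h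
      have h1 : f * X ^ (d + 1) = g * C (w : ℤ) := by
        apply mul_right_cancel₀ (pow_ne_zero j (X_ne_zero (R := ℤ)))
        rw [← key]
        ring
      rw [← h1] at hgw
      simp at hgw
  subst haj
  have h1 : f = g * C (w : ℤ) := mul_right_cancel₀ (pow_ne_zero a (X_ne_zero (R := ℤ))) key
  rcases Int.units_eq_one_or w with rfl | rfl
  · simpa using h1
  · rw [h1] at hf
    simp at hf
    omega

open Polynomial in
theorem altGeomSum_X_coeff_zero (n : ℕ) : (altGeomSum (X : ℤ[X]) (n + 1)).coeff 0 = 1 := by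
  rw [altGeomSum_succ']
  simp

open Classical in
/-- The reduced Alexander polynomial of `T_{2,b}`, if it exists, is `1 - t + ⋯ + t^(|b|-1)`. -/
theorem eq_altGeomSum_of_isReducedAlexander {b : ℤ} (hb : IsCoprime 2 b) {f : Polynomial ℤ}
    (hf : (torusKnot 2 b hb).IsReducedAlexander f) :
    f = altGeomSum Polynomial.X b.natAbs := by
  obtain ⟨hf0, hf⟩ := hf
  have h0 := ne_zero_of_isCoprime_two hb
  obtain ⟨h, e⟩ := odd_of_isCoprime_two hb
  have hcard := card_torusDiagram_arc hb
  have hn0 : 0 < b.natAbs := Int.natAbs_pos.2 h0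
  refine eq_of_associated_toLaurent hf0 ?_ ?_
  · obtain ⟨n, hn⟩ := Nat.exists_eq_succ_of_ne_zero hn0.ne'
    rw [hn, altGeomSum_X_coeff_zero]
    exact one_pos
  obtain hn | ⟨k, hn⟩ : b.natAbs = 1 ∨ ∃ k, b.natAbs = k + 3 := by
    rcases lt_or_ge b.natAbs 3 with h3 | h3
    · left; omega
    · exact Or.inr ⟨b.natAbs - 3, by omega⟩
  -- One crossing and one arc: the minor is the empty determinant `1`.
  · have := hf _ (torusDiagram_isDiagramOf b hb) 0 ⟨Fin.elim0, fun i => i.elim0⟩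
      ⟨Fin.elim0, fun i => i.elim0⟩ (by rw [hcard, hn])
    rw [Matrix.det_isEmpty] at this
    rwa [hn, altGeomSum_one, map_one]
  · have hd : ∀ {x : ℤ}, b ∣ x → |x| < k + 3 → x = 0 := fun hx hlt =>
      Int.eq_zero_of_abs_lt_dvd ((abs_dvd _ _).2 hx) (by rw [← Int.natCast_natAbs b]; omega)
    have hbk : b ∣ (k + 3 : ℤ) := by rw [← Int.natAbs_dvd, hn]; exact ⟨1, by push_cast; ring⟩
    -- The crossing and the strand of index `0` are deleted, so the remaining indices are `1, …, k +
    -- 2`.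
    let r : Fin (k + 2) ↪ (torusDiagram b hb).Crossing :=
      ⟨fun i => torusCrossing b hb (-(h * (i + 1 : ℕ))), fun i j hij => by
        have := hd ((torusCrossing_neg_mul_eq_iff e).1 hij) (by rw [abs_lt]; omega)
        ext; omega⟩
    let s : Fin (k + 2) ↪ (torusDiagram b hb).Arc :=
      ⟨fun i => torusStrand b hb h (i + 1 : ℕ), fun i j hij => by
        have := hd ((torusStrand_eq_iff e).1 hij) (by rw [abs_lt]; omega)
        ext; omega⟩
    have h1 := hf _ (torusDiagram_isDiagramOf b hb) (k + 2) r s (by rw [hcard, hn])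
    rw [det_recursion_matrix (LaurentPolynomial.T 1) k] at h1
    · rw [map_altGeomSum, Polynomial.toLaurent_X, hn]
      exact (associated_unit_mul_right _ _ (isUnit_one.neg.pow k)).trans h1
    · intro i j
      refine (torusDiagram_alexanderMatrix_apply e (i + 1 : ℕ) (s j)).trans ?_
      have hs : ∀ l : ℤ, torusStrand b hb h l = s j ↔ b ∣ l - (j + 1 : ℕ) :=
        fun l => torusStrand_eq_iff e
      have hi := i.2
      have hj := j.2
      congr 1
      · congr 1
        · refine if_congr ((hs _).trans ⟨fun h => ?_, ?_⟩) rfl rfl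
          -- For `i < j` the congruence wraps around the period `k + 3`, which happens only in the
          -- corner entry `i = 0`, `j = k + 1`.
          · by_cases hij : (i : ℤ) - j < 0
            · have := hd (dvd_add h hbk) (by rw [abs_lt]; omega)
              omega
            · have := hd h (by rw [abs_lt]; omega)
              omega
          · rintro (h | ⟨h, h'⟩)
            · rw [h]; exact ⟨0, by push_cast; ring⟩
            · rw [show ((i + 1 : ℕ) : ℤ) - 2 - (j + 1 : ℕ) = -(k + 3) by omega, dvd_neg]
              exact hbk
        · refine if_congr ((hs _).trans ⟨fun h => ?_, ?_⟩) rfl rfl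
          · have := hd h (by rw [abs_lt]; omega)
            omega
          · intro h
            rw [h, sub_self]; exact dvd_zero b
      · refine if_congr ((hs _).trans ⟨fun h => ?_, ?_⟩) rfl rfl
        · have := hd h (by rw [abs_lt]; omega)
          omega
        · intro h
          rw [h]; exact ⟨0, by push_cast; ring⟩

/-! ### Size and residues of the values at `m` -/

section bounds

variable {m : ℤ} {n : ℕ}

theorem one_add_mul_altGeomSum_odd (hn : Odd n) : (1 + m) * altGeomSum m n = 1 + m ^ n := by
  rw [one_add_mul_altGeomSum, hn.neg_pow]
  ring

/-- After multiplication by `1 + m` the gap is at least `1 + m³ - m - m² = (m - 1)²(m + 1) > 0`. -/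
theorem lt_altGeomSum (hm : 1 < m) (hn : Odd n) (h3 : 3 ≤ n) : m < altGeomSum m n := by
  have h1 := one_add_mul_altGeomSum_odd (m := m) hn
  have h2 : m ^ 3 ≤ m ^ n := pow_le_pow_right₀ hm.le h3
  refine lt_of_mul_lt_mul_left ?_ (show 0 ≤ 1 + m by linarith)
  rw [h1]
  nlinarith [mul_pos (show 0 < m by linarith) (show 0 < m - 1 by linarith),
    mul_pos (show 0 < m by linarith) (mul_pos (show 0 < m - 1 by linarith)
      (show 0 < m - 1 by linarith))]

/-- After multiplication by `1 + m` the left side is at most `1 + m^d` and the right side equals `1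
+ m^n`. -/
theorem abs_altGeomSum_lt (hm : 1 < m) (hn : Odd n) {d : ℕ} (hd : d < n) :
    |altGeomSum m d| < altGeomSum m n := by
  have h1 := one_add_mul_altGeomSum_odd (m := m) hn
  have h2 : m ^ d < m ^ n := pow_lt_pow_right₀ hm hd
  refine lt_of_mul_lt_mul_left ?_ (show 0 ≤ 1 + m by linarith)
  rw [h1]
  nth_rewrite 1 [← abs_of_pos (show 0 < 1 + m by linarith)]
  rw [← abs_mul, one_add_mul_altGeomSum]
  refine (abs_sub _ _).trans_lt ?_
  rw [abs_pow, abs_neg, abs_one, abs_of_pos (show 0 < m by linarith)]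
  linarith

theorem altGeomSum_ne_zero (hm : 1 < m) {d : ℕ} (hd : d ≠ 0) : altGeomSum m d ≠ 0 := by
  intro h
  have h1 := one_add_mul_altGeomSum m d
  rw [h, mul_zero] at h1
  have h2 := congrArg abs (sub_eq_zero.1 h1.symm)
  rw [abs_pow, abs_neg, abs_one, abs_of_pos (show 0 < m by linarith)] at h2
  have := one_lt_pow₀ hm hd
  linarith

variable {p : ℕ}

/-- Since `(-m)^n = 1 - (1 + m) S_n ≡ 1` modulo `p = S_n`, `S_{n+i} = S_n + (-m)^n S_i ≡ S_i`. -/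
theorem altGeomSum_periodic (hp : altGeomSum m n = p) :
    Function.Periodic (fun i => ((altGeomSum m i : ℤ) : ZMod p)) n := by
  intro i
  have h1 := one_add_mul_altGeomSum m n
  have h2 := altGeomSum_add m n i
  have h3 : altGeomSum m (i + n) = altGeomSum m i + p * (1 - (1 + m) * altGeomSum m i) := by
    rw [add_comm, h2, ← hp]
    linear_combination altGeomSum m i * h1
  simp [h3]

/-- The difference `(-m)^i S_{j-i}` is not divisible by the prime `p`: `0 < m < p` handles the
power, and `S_{j-i}` is nonzero and smaller than `p` in absolute value. -/
theorem altGeomSum_cast_ne (hpp : p.Prime) (hm : 1 < m) (hn : Odd n) (h3 : 3 ≤ n)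
    (hp : altGeomSum m n = p) {i j : ℕ} (hij : i < j) (hj : j < n) :
    ((altGeomSum m i : ℤ) : ZMod p) ≠ (altGeomSum m j : ℤ) := by
  intro h
  obtain ⟨d, rfl⟩ := Nat.exists_eq_add_of_lt hij
  rw [ZMod.intCast_eq_intCast_iff_dvd_sub, add_assoc, altGeomSum_add, add_sub_cancel_left] at h
  rcases (Nat.prime_iff_prime_int.1 hpp).dvd_or_dvd h with h | h
  · have h1 := (Nat.prime_iff_prime_int.1 hpp).dvd_of_dvd_pow h
    rw [dvd_neg] at h1
    have := Int.le_of_dvd (by linarith) h1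
    have := lt_altGeomSum hm hn h3
    linarith
  · have h1 := Int.eq_zero_of_abs_lt_dvd h
      (by rw [← hp]; exact abs_altGeomSum_lt hm hn (by omega))
    exact altGeomSum_ne_zero hm (Nat.succ_ne_zero d) h1

end bounds

/-! ### The proposition -/

theorem mainTheorem6 (b : ℤ) (hb : IsCoprime (2 : ℤ) b) (p : ℕ) (m : ℤ) (hp : p.Prime)
    (hm : 1 < m) (hpm : (torusKnot 2 b hb).reducedAlexander.eval m = p) :
    (torusKnot 2 b hb).DisplaysKH p m := by
  -- Otherwise the default polynomial `0` would evaluate to the prime `p`.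
  have hex : ∃ f, (torusKnot 2 b hb).IsReducedAlexander f := by
    by_contra hne
    rw [Knot.reducedAlexander, dif_neg hne, Polynomial.eval_zero] at hpm
    exact hp.ne_zero (by exact_mod_cast hpm.symm)
  have hS : altGeomSum m b.natAbs = p := by
    rw [← hpm, Knot.reducedAlexander, dif_pos hex,
      eq_altGeomSum_of_isReducedAlexander hb hex.choose_spec]
    have := map_altGeomSum Polynomial.X (Polynomial.evalRingHom m) b.natAbs
    simpa using this.symm
  have hodd : Odd b.natAbs := Int.natAbs_odd.2 (odd_of_isCoprime_two hb)
  have h3 : 3 ≤ b.natAbs := by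
    by_contra! hlt
    obtain ⟨c, hc⟩ := hodd
    have h1 : b.natAbs = 1 := by omega
    rw [h1, altGeomSum_one] at hS
    exact hp.one_lt.ne (by exact_mod_cast hS)
  have hmp : m < p := hS ▸ lt_altGeomSum hm hodd h3
  obtain ⟨h, e⟩ := odd_of_isCoprime_two hb
  choose idx hlt hidx using exists_torusStrand_eq (hb := hb) e
  have hper := altGeomSum_periodic hS
  -- `idx` selects the representative below `|b|`; by periodicity any natural index gives the same
  -- color, so the recursion holds across the wrap-around too.
  have hval : ∀ i : ℕ, ((altGeomSum m (idx (torusStrand b hb h i)) : ℤ) : ZMod p) =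
      (altGeomSum m i : ℤ) := by
    intro i
    have h1 := (torusStrand_eq_iff e).1 (hidx (torusStrand b hb h i))
    have h2 : idx (torusStrand b hb h i) ≡ i [MOD b.natAbs] :=
      (Nat.modEq_iff_dvd.2 (Int.natAbs_dvd.2 h1)).symm
    exact (hper.map_mod_nat _).symm.trans
      ((congrArg (fun j => ((altGeomSum m j : ℤ) : ZMod p)) h2).trans (hper.map_mod_nat i))
  have hinj : Function.Injective fun a : (torusDiagram b hb).Arc =>
      ((altGeomSum m (idx a) : ℤ) : ZMod p) := by
    intro a a' haa
    rw [← hidx a, ← hidx a']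
    rcases lt_trichotomy (idx a) (idx a') with hl | hl | hl
    · exact absurd haa (altGeomSum_cast_ne hp hm hodd h3 hS hl (hlt a'))
    · rw [hl]
    · exact absurd haa.symm (altGeomSum_cast_ne hp hm hodd h3 hS hl (hlt a))
  refine ⟨hp, hm, hmp, hpm, torusDiagram b hb, torusDiagram_isDiagramOf b hb,
    torusDiagram_isReduced hb (by rw [← Int.natCast_natAbs]; exact_mod_cast h3),
    torusDiagram_isAlternating b hb,
    fun a => ((altGeomSum m (idx a) : ℤ) : ZMod p), torusDiagram_isColoring e m _ fun i => ?_,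
    ⟨torusStrand b hb h 0, torusStrand b hb h 1, fun heq => ?_⟩, hinj⟩
  · simp only [hval, altGeomSum_add_two m i]
    push_cast
    rfl
  · have h2 := Int.natAbs_dvd_natAbs.2 ((torusStrand_eq_iff e).1 (hinj heq))
    have := Nat.le_of_dvd (by norm_num) h2
    simp at this
    omega
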